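/- For closed convex sets $K,L\subset\mathbb{R}^n$ let $g_{K,L}(x):=|K\cap(L+x)|\in[0,\infty]$ ($x\in\mathbb{R}^n$) denote their cross covariogram, where $|\cdot|$ is $n$-dimensional Lebesgue measure. Assume that $0<g_{K,L}(b)<\infty$ for some $b\in\mathbb{R}^n$. Let $a,w\in\mathbb{R}^n$ with $w\neq 0$, and suppose that $$g_{K,L}(a+tw)=g_{K,L}(a)>0\qquad\text{for all } t\in[-1,1].$$ Then there exists a vector $v\in\mathbb{R}^n$ such that $$K\cap(L+a+tw)=K'\cap(L'+tw)\qquad\text{for all } t\in[-1,1],$$ where $$K':=\{x+sv \mid x\in K,\ s\in\mathbb{R}\},\qquad L':=\{x+s(v-w)\mid x\in L+a,\ s\in\mathbb{R}\}.$$ (If $v\ne 0$, $K'$ is the cylinder in direction $v$ generated by $K$, and $K'=K$ if $v=0$; likewise for $L'$ with $v-w$ and $L+a$.) -/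

import Mathlib

/-- The translate `A + x = {y + x | y ∈ A}` of a set `A ⊆ ℝⁿ` by a vector `x`. -/
def translateBy {n : ℕ} (A : Set (EuclideanSpace ℝ (Fin n))) (x : EuclideanSpace ℝ (Fin n)) :
    Set (EuclideanSpace ℝ (Fin n)) :=
  (fun y => y + x) '' A

/-- The cross covariogram `g_{K,L}(x) = |K ∩ (L + x)|`, with values in `[0, ∞]`. -/
noncomputable def crossCovariogram {n : ℕ} (K L : Set (EuclideanSpace ℝ (Fin n)))
    (x : EuclideanSpace ℝ (Fin n)) : ENNReal :=
  MeasureTheory.volume (K ∩ translateBy L x)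

/-- The set `{x + t v | x ∈ A, t ∈ ℝ}`: the cylinder in the direction of `v` generated by `A`
if `v ≠ 0`, and `A` itself if `v = 0`. -/
def cylinderGen {n : ℕ} (A : Set (EuclideanSpace ℝ (Fin n))) (v : EuclideanSpace ℝ (Fin n)) :
    Set (EuclideanSpace ℝ (Fin n)) :=
  {y | ∃ x ∈ A, ∃ t : ℝ, y = x + t • v}

open MeasureTheory Set Filter Topology Pointwise

/-! Put M = L + a and C_t = K ∩ (M + tw). Convexity gives l C_p + k C_q ⊆ C_{lp+kq} for weights l +
k = 1, so constancy of the volume means equality in Brunn–Minkowski: C_1 = C_{-1} + c for some c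
(`exists_eq_image_add`). Then C_{-1} + ((1+t)/2)c ⊆ C_t with equal volumes, hence C_t = C_0 + tv
with v = c/2. So C_0 slides along v inside K and along v - w inside M, and a segment from C_0 to a
point common to both cylinders can never leave C_0 (`mem_inter_of_mem_cylinders`). The condition 0 <
g(b) < ∞ excludes common recession directions and makes every C_t compact.

The equality case is proved through one-dimensional marginals. Prékopa–Leindler normalised by
suprema has an arithmetic mean on its left side, and equality in AM–GM forces equal suprema. Applied
on both sides of matching quantiles, this gives equal densities there, so the quantile functions
differ by a constant (`exists_withDensity_eq_map`). Hence every linear functional has translated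
marginals on the two bodies, the shift being its value at the difference of centroids; separation
and equality of volumes then finish. -/

/-! ### Brunn–Minkowski on the line -/

theorem volume_image_mul_add (X : Set ℝ) {l : ℝ} (hl : 0 < l) (c : ℝ) :
    volume ((fun x => l * x + c) '' X) = ENNReal.ofReal l * volume X := by
  have : (fun x => l * x + c) '' X = (fun x => x + c) '' (l • X) := by
    rw [← image_smul, image_image]; rfl
  rw [this, image_add_right, measure_preimage_add_right, Measure.addHaar_smul]
  simp [abs_of_pos hl]

/-- With x = max X and y = min Y, the sets lX + ky and lx + kY both lie in W and meet only at lx +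
ky. -/
theorem volume_weighted_add_le_of_isCompact {X Y W : Set ℝ} (hX : IsCompact X) (hY : IsCompact Y)
    (hX0 : X.Nonempty) (hY0 : Y.Nonempty) {l k : ℝ} (hl : 0 < l) (hk : 0 < k)
    (h : ∀ x ∈ X, ∀ y ∈ Y, l * x + k * y ∈ W) :
    ENNReal.ofReal l * volume X + ENNReal.ofReal k * volume Y ≤ volume W := by
  obtain ⟨x, hx, hxm⟩ := hX.exists_isGreatest hX0
  obtain ⟨y, hy, hym⟩ := hY.exists_isLeast hY0
  rw [← volume_image_mul_add X hl (k * y), ← volume_image_mul_add Y hk (l * x)]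
  have hm : MeasurableSet ((fun y => k * y + l * x) '' Y) :=
    (hY.image (by fun_prop)).measurableSet
  have hd : AEDisjoint volume ((fun x => l * x + k * y) '' X) ((fun y => k * y + l * x) '' Y) := by
    refine measure_mono_null (t := {l * x + k * y}) ?_ (by simp)
    rintro _ ⟨⟨x', hx', rfl⟩, ⟨y', hy', h'⟩⟩
    have h1 := mul_le_mul_of_nonneg_left (hxm hx') hl.le
    have h2 := mul_le_mul_of_nonneg_left (hym hy') hk.le
    simp only [mem_singleton_iff] at h' ⊢
    linarith
  rw [← measure_union₀ hm.nullMeasurableSet hd]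
  refine measure_mono ?_
  rintro _ (⟨x', hx', rfl⟩ | ⟨y', hy', rfl⟩)
  · exact h x' hx' y hy
  · simpa [add_comm] using h x hx y' hy'

/-- Inner regularity; it is applied to each summand in turn. The null case is separate because no r
< 0 exists, and a single point serves there. -/
theorem mul_volume_add_le_of_isCompact {X : Set ℝ} (hX : MeasurableSet X) (hX0 : X.Nonempty)
    {l b c : ENNReal} (hl : l ≠ ⊤)
    (h : ∀ K ⊆ X, IsCompact K → K.Nonempty → l * volume K + b ≤ c) :
    l * volume X + b ≤ c := by
  by_cases h0 : volume X = 0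
  · obtain ⟨x, hx⟩ := hX0
    have := h {x} (by simpa using hx) isCompact_singleton (singleton_nonempty x)
    simpa [h0] using this
  · have : (𝓝[<] volume X).NeBot := nhdsLT_neBot_of_exists_lt ⟨0, pos_iff_ne_zero.2 h0⟩
    have ht : Tendsto (fun r => l * r + b) (𝓝[<] volume X) (𝓝 (l * volume X + b)) :=
      (((ENNReal.continuous_const_mul hl).add continuous_const).tendsto _).mono_left
        nhdsWithin_le_nhds
    refine le_of_tendsto ht ?_
    filter_upwards [self_mem_nhdsWithin] with r hr
    obtain ⟨K, hK, hKc, hKr⟩ := hX.exists_lt_isCompact hr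
    refine le_trans ?_ (h K hK hKc (nonempty_of_measure_ne_zero (ne_bot_of_gt hKr)))
    gcongr

/-- One-dimensional Brunn–Minkowski inequality. -/
theorem volume_weighted_add_le {X Y W : Set ℝ} (hX : MeasurableSet X) (hY : MeasurableSet Y)
    (hX0 : X.Nonempty) (hY0 : Y.Nonempty) {l k : ℝ} (hl : 0 < l) (hk : 0 < k)
    (h : ∀ x ∈ X, ∀ y ∈ Y, l * x + k * y ∈ W) :
    ENNReal.ofReal l * volume X + ENNReal.ofReal k * volume Y ≤ volume W := by
  refine mul_volume_add_le_of_isCompact hX hX0 ENNReal.ofReal_ne_top fun J hJ hJc hJ0 => ?_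
  rw [add_comm]
  refine mul_volume_add_le_of_isCompact hY hY0 ENNReal.ofReal_ne_top fun K hK hKc hK0 => ?_
  rw [add_comm]
  exact volume_weighted_add_le_of_isCompact hJc hKc hJ0 hK0 hl hk
    fun x hx y hy => h x (hJ hx) y (hK hy)

/-! ### Prékopa–Leindler on the line -/

/-- Layer cake: below level 1 both superlevel sets on the left are nonempty, so Brunn–Minkowski on
the line applies; from level 1 on they are empty. -/
theorem lintegral_weighted_add_le {F G H : ℝ → ℝ} (hF : Measurable F) (hG : Measurable G)
    (hH : Measurable H) (hF0 : 0 ≤ F) (hG0 : 0 ≤ G) (hH0 : 0 ≤ H) (hF1 : F ≤ 1) (hG1 : G ≤ 1)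
    (hF2 : ∀ r < 1, ∃ s, r < F s) (hG2 : ∀ r < 1, ∃ s, r < G s) {l k : ℝ} (hl : 0 < l)
    (hk : 0 < k) (h : ∀ s t r, 0 < r → r < F s → r < G t → r < H (l * s + k * t)) :
    ENNReal.ofReal l * (∫⁻ s, ENNReal.ofReal (F s)) +
      ENNReal.ofReal k * (∫⁻ s, ENNReal.ofReal (G s)) ≤ ∫⁻ s, ENNReal.ofReal (H s) := by
  rw [lintegral_eq_lintegral_meas_lt volume (ae_of_all _ hF0) hF.aemeasurable,
    lintegral_eq_lintegral_meas_lt volume (ae_of_all _ hG0) hG.aemeasurable,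
    lintegral_eq_lintegral_meas_lt volume (ae_of_all _ hH0) hH.aemeasurable,
    ← lintegral_const_mul' _ _ ENNReal.ofReal_ne_top,
    ← lintegral_const_mul' _ _ ENNReal.ofReal_ne_top]
  have hanti : ∀ f : ℝ → ℝ, Measurable fun r => volume {a | r < f a} := fun f =>
    Antitone.measurable fun r r' hr => measure_mono fun a (ha : r' < f a) => lt_of_le_of_lt hr ha
  rw [← lintegral_add_left ((hanti F).const_mul _)]
  refine setLIntegral_mono (hanti H) fun r (hr : 0 < r) => ?_
  by_cases hr1 : r < 1
  · exact volume_weighted_add_le (measurableSet_lt measurable_const hF)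
      (measurableSet_lt measurable_const hG) (hF2 r hr1) (hG2 r hr1) hl hk
      fun x hx y hy => h x y r hr hx hy
  · have e1 : {a | r < F a} = ∅ := by
      ext a; simpa using (hF1 a).trans (not_lt.1 hr1)
    have e2 : {a | r < G a} = ∅ := by
      ext a; simpa using (hG1 a).trans (not_lt.1 hr1)
    simp [e1, e2]

/-- Prékopa–Leindler inequality on the line, in the sharper form normalised by the suprema. -/
theorem integral_div_iSup_add_le {F G H : ℝ → ℝ} (hF : Measurable F) (hG : Measurable G)
    (hH : Measurable H) (hF0 : 0 ≤ F) (hG0 : 0 ≤ G) (hH0 : 0 ≤ H) (hFb : BddAbove (range F))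
    (hGb : BddAbove (range G)) (hFi : Integrable F) (hGi : Integrable G) (hHi : Integrable H)
    (hFp : 0 < ⨆ s, F s) (hGp : 0 < ⨆ s, G s) {l k : ℝ} (hl : 0 < l) (hk : 0 < k)
    (hlk : l + k = 1) (h : ∀ s t, F s ^ l * G t ^ k ≤ H (l * s + k * t)) :
    l * ((∫ s, F s) / ⨆ s, F s) + k * ((∫ s, G s) / ⨆ s, G s) ≤
      (∫ s, H s) / ((⨆ s, F s) ^ l * (⨆ s, G s) ^ k) := by
  set M := ⨆ s, F s
  set N := ⨆ s, G s
  have hMN : 0 < M ^ l * N ^ k := by positivity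
  have hsup : ∀ f : ℝ → ℝ, BddAbove (range f) → 0 < (⨆ s, f s) → ∀ r < 1,
      ∃ s, r < f s / ⨆ s, f s := by
    intro f hf hp r hr
    obtain ⟨s, hs⟩ := exists_lt_of_lt_ciSup (f := f) (b := r * ⨆ s, f s)
      (by nlinarith)
    exact ⟨s, (lt_div_iff₀ hp).2 hs⟩
  have := lintegral_weighted_add_le (F := fun s => F s / M) (G := fun s => G s / N)
    (H := fun s => H s / (M ^ l * N ^ k)) (hF.div_const _) (hG.div_const _) (hH.div_const _)
    (fun s => div_nonneg (hF0 s) hFp.le) (fun s => div_nonneg (hG0 s) hGp.le)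
    (fun s => div_nonneg (hH0 s) hMN.le)
    (fun s => (div_le_one hFp).2 (le_ciSup hFb s)) (fun s => (div_le_one hGp).2 (le_ciSup hGb s))
    (hsup F hFb hFp) (hsup G hGb hGp) hl hk (fun s t r hr hs ht => by
      have e : r = r ^ l * r ^ k := by rw [← Real.rpow_add hr, hlk, Real.rpow_one]
      calc r = r ^ l * r ^ k := e
        _ < (F s / M) ^ l * (G t / N) ^ k := by gcongr
        _ = (F s ^ l * G t ^ k) / (M ^ l * N ^ k) := by
          rw [Real.div_rpow (hF0 s) hFp.le, Real.div_rpow (hG0 t) hGp.le, div_mul_div_comm]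
        _ ≤ _ := by gcongr; exact h s t)
  rw [← ofReal_integral_eq_lintegral_ofReal (hFi.div_const _)
      (ae_of_all _ fun s => div_nonneg (hF0 s) hFp.le),
    ← ofReal_integral_eq_lintegral_ofReal (hGi.div_const _)
      (ae_of_all _ fun s => div_nonneg (hG0 s) hGp.le),
    ← ofReal_integral_eq_lintegral_ofReal (hHi.div_const _)
      (ae_of_all _ fun s => div_nonneg (hH0 s) hMN.le),
    ← ENNReal.ofReal_mul hl.le, ← ENNReal.ofReal_mul hk.le, integral_div, integral_div,
    integral_div, ← ENNReal.ofReal_add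
      (mul_nonneg hl.le (div_nonneg (integral_nonneg hF0) hFp.le))
      (mul_nonneg hk.le (div_nonneg (integral_nonneg hG0) hGp.le)),
    ENNReal.ofReal_le_ofReal_iff (div_nonneg (integral_nonneg hH0) hMN.le)] at this
  exact this

/-- Prékopa–Leindler inequality on the line. -/
theorem integral_rpow_mul_le {F G H : ℝ → ℝ} (hF : Measurable F) (hG : Measurable G)
    (hH : Measurable H) (hF0 : 0 ≤ F) (hG0 : 0 ≤ G) (hH0 : 0 ≤ H) (hFb : BddAbove (range F))
    (hGb : BddAbove (range G)) (hFi : Integrable F) (hGi : Integrable G) (hHi : Integrable H)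
    {l k : ℝ} (hl : 0 < l) (hk : 0 < k)
    (hlk : l + k = 1) (h : ∀ s t, F s ^ l * G t ^ k ≤ H (l * s + k * t)) :
    (∫ s, F s) ^ l * (∫ s, G s) ^ k ≤ ∫ s, H s := by
  have hz : ∀ f : ℝ → ℝ, 0 ≤ f → BddAbove (range f) → ¬ (0 < ⨆ s, f s) → ∫ s, f s = 0 := by
    intro f hf hb hn
    have : f = 0 := by
      ext s
      exact le_antisymm ((le_ciSup hb s).trans (not_lt.1 hn)) (hf s)
    simp [this]
  by_cases hFp : 0 < ⨆ s, F s
  swap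
  · rw [hz F hF0 hFb hFp, Real.zero_rpow hl.ne', zero_mul]; exact integral_nonneg hH0
  by_cases hGp : 0 < ⨆ s, G s
  swap
  · rw [hz G hG0 hGb hGp, Real.zero_rpow hk.ne', mul_zero]; exact integral_nonneg hH0
  have iF : 0 ≤ ∫ s, F s := integral_nonneg hF0
  have iG : 0 ≤ ∫ s, G s := integral_nonneg hG0
  have h1 := integral_div_iSup_add_le hF hG hH hF0 hG0 hH0 hFb hGb hFi hGi hHi hFp hGp hl hk hlk h
  -- AM–GM bounds the left side below by a geometric mean, whose denominator cancels that of the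
  -- right side.
  have h2 := Real.geom_mean_le_arith_mean2_weighted hl.le hk.le
    (div_nonneg iF hFp.le) (div_nonneg iG hGp.le) hlk
  have h3 := h2.trans h1
  rw [Real.div_rpow iF hFp.le, Real.div_rpow iG hGp.le,
    div_mul_div_comm, div_le_div_iff_of_pos_right (by positivity)] at h3
  exact h3

/-! ### Section volumes of compact sets -/

section Sections

set_option linter.unusedSectionVars false

variable {Y : Type*} [NormedAddCommGroup Y] [MeasurableSpace Y] [BorelSpace Y]
  [SecondCountableTopology Y]

/-- The measure of the section of `A` over `s`. -/
noncomputable def sectionVol (ν : Measure Y) (A : Set (ℝ × Y)) (s : ℝ) : ℝ :=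
  ν.real (Prod.mk s ⁻¹' A)

variable (ν : Measure Y) {A B C : Set (ℝ × Y)}

theorem isCompact_section (hA : IsCompact A) (s : ℝ) : IsCompact (Prod.mk s ⁻¹' A) :=
  (hA.image continuous_snd).of_isClosed_subset (hA.isClosed.preimage (by fun_prop))
    fun y hy => ⟨(s, y), hy, rfl⟩

theorem sectionVol_nonneg (A : Set (ℝ × Y)) : 0 ≤ sectionVol ν A := fun _ => measureReal_nonneg

theorem measurable_sectionVol [SFinite ν] (hA : IsCompact A) : Measurable (sectionVol ν A) :=
  (measurable_measure_prodMk_left hA.measurableSet).ennreal_toReal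

theorem bddAbove_range_sectionVol [IsFiniteMeasureOnCompacts ν] (hA : IsCompact A) :
    BddAbove (range (sectionVol ν A)) := by
  refine ⟨ν.real (Prod.snd '' A), ?_⟩
  rintro _ ⟨s, rfl⟩
  exact measureReal_mono (fun y hy => ⟨(s, y), hy, rfl⟩)
    (hA.image continuous_snd).measure_lt_top.ne

theorem lintegral_ofReal_sectionVol [SFinite ν] [IsFiniteMeasureOnCompacts ν] (hA : IsCompact A)
    {T : Set ℝ} (hT : MeasurableSet T) :
    ∫⁻ s in T, ENNReal.ofReal (sectionVol ν A s) =
      (volume.prod ν) (A ∩ Prod.fst ⁻¹' T) := by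
  rw [Measure.prod_apply (hA.measurableSet.inter (measurable_fst hT)), ← lintegral_indicator hT]
  congr with s
  by_cases hs : s ∈ T
  · simp only [indicator_of_mem hs, preimage_inter]
    have : (Prod.mk s : Y → ℝ × Y) ⁻¹' (Prod.fst ⁻¹' T) = univ := by ext; simp [hs]
    rw [this, inter_univ]
    exact ENNReal.ofReal_toReal (isCompact_section hA s).measure_lt_top.ne
  · simp only [indicator_of_notMem hs, preimage_inter]
    have : (Prod.mk s : Y → ℝ × Y) ⁻¹' (Prod.fst ⁻¹' T) = ∅ := by ext; simp [hs]
    simp [this]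

theorem integrable_sectionVol [SFinite ν] [IsFiniteMeasureOnCompacts ν] (hA : IsCompact A) :
    Integrable (sectionVol ν A) :=
  Measure.integrable_measure_prodMk_left hA.measurableSet hA.measure_lt_top.ne

theorem integral_sectionVol [SFinite ν] [IsFiniteMeasureOnCompacts ν] (hA : IsCompact A) :
    ∫ s, sectionVol ν A s = (volume.prod ν).real A := by
  rw [integral_eq_lintegral_of_nonneg_ae (ae_of_all _ (sectionVol_nonneg ν A))
    (measurable_sectionVol ν hA).aestronglyMeasurable, ← setLIntegral_univ,
    lintegral_ofReal_sectionVol ν hA MeasurableSet.univ]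
  simp [measureReal_def]

end Sections

/-! ### Brunn–Minkowski by induction on the dimension -/

/-- A measure satisfies the Brunn–Minkowski inequality in its multiplicative form on compact
sets. -/
def IsBrunnMinkowski {Y : Type*} [NormedAddCommGroup Y] [NormedSpace ℝ Y] [MeasurableSpace Y]
    (ν : Measure Y) : Prop :=
  ∀ A B C : Set Y, IsCompact A → IsCompact B → IsCompact C → ∀ l k : ℝ, 0 < l → 0 < k →
    l + k = 1 → (∀ a ∈ A, ∀ b ∈ B, l • a + k • b ∈ C) → ν.real A ^ l * ν.real B ^ k ≤ ν.real C

namespace IsBrunnMinkowski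

variable {Y : Type*} [NormedAddCommGroup Y] [NormedSpace ℝ Y] [MeasurableSpace Y] [BorelSpace Y]
  [SecondCountableTopology Y] {ν : Measure Y}

theorem sectionVol_le (h : IsBrunnMinkowski ν) {A B C : Set (ℝ × Y)} (hA : IsCompact A)
    (hB : IsCompact B) (hC : IsCompact C) {l k : ℝ} (hl : 0 < l) (hk : 0 < k) (hlk : l + k = 1)
    (hABC : ∀ a ∈ A, ∀ b ∈ B, l • a + k • b ∈ C) (s t : ℝ) :
    sectionVol ν A s ^ l * sectionVol ν B t ^ k ≤ sectionVol ν C (l * s + k * t) :=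
  h _ _ _ (isCompact_section hA s) (isCompact_section hB t) (isCompact_section hC _) l k hl hk hlk
    fun a ha b hb => hABC (s, a) ha (t, b) hb

/-- The induction step: section volumes satisfy the hypothesis of Prékopa–Leindler, and their
integrals are the volumes by Fubini. -/
theorem prod [SFinite ν] [IsFiniteMeasureOnCompacts ν] (h : IsBrunnMinkowski ν) :
    IsBrunnMinkowski ((volume : Measure ℝ).prod ν) := by
  intro A B C hA hB hC l k hl hk hlk hABC
  rw [← integral_sectionVol ν hA, ← integral_sectionVol ν hB, ← integral_sectionVol ν hC]
  exact integral_rpow_mul_le (measurable_sectionVol ν hA) (measurable_sectionVol ν hB)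
    (measurable_sectionVol ν hC) (sectionVol_nonneg ν A) (sectionVol_nonneg ν B)
    (sectionVol_nonneg ν C) (bddAbove_range_sectionVol ν hA) (bddAbove_range_sectionVol ν hB)
    (integrable_sectionVol ν hA) (integrable_sectionVol ν hB) (integrable_sectionVol ν hC)
    hl hk hlk (h.sectionVol_le hA hB hC hl hk hlk hABC)

end IsBrunnMinkowski

theorem isBrunnMinkowski_volume_pi (m : ℕ) :
    IsBrunnMinkowski (volume : Measure (Fin m → ℝ)) := by
  induction m with
  | zero =>
    intro A B C _ _ _ l k hl hk hlk h
    rcases A.eq_empty_or_nonempty with rfl | ⟨a, ha⟩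
    · simp [Real.zero_rpow hl.ne']
    rcases B.eq_empty_or_nonempty with rfl | ⟨b, hb⟩
    · simp [Real.zero_rpow hk.ne']
    have := h a ha b hb
    have e : ∀ {S : Set (Fin 0 → ℝ)} {x}, x ∈ S → S = univ := fun {S x} hx =>
      eq_univ_of_forall fun y => by rwa [Subsingleton.elim y x]
    rw [e ha, e hb, e this]
    simp [measureReal_def, volume_pi]
  | succ m ih =>
    intro A B C hA hB hC l k hl hk hlk h
    let e := MeasurableEquiv.piFinSuccAbove (fun _ : Fin (m + 1) => ℝ) 0
    have he : MeasurePreserving e volume volume := volume_preserving_piFinSuccAbove _ 0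
    have hcont : Continuous e := by
      refine Continuous.prodMk (continuous_apply 0) ?_
      exact continuous_pi fun j => continuous_apply _
    have hr : ∀ S : Set (Fin (m + 1) → ℝ), volume.real S = volume.real (e '' S) := by
      intro S
      rw [measureReal_def, measureReal_def, ← he.measure_preimage_equiv (e '' S),
        preimage_image_eq _ e.injective]
    rw [hr A, hr B, hr C]
    refine ih.prod _ _ _ (hA.image hcont) (hB.image hcont) (hC.image hcont) l k hl hk hlk ?_
    rintro _ ⟨a, ha, rfl⟩ _ ⟨b, hb, rfl⟩
    exact ⟨_, h a ha b hb, rfl⟩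

/-! ### Equality in Prékopa–Leindler on the line -/

/-- Bounded integrable densities on the line. -/
structure IsBoundedDensity (F : ℝ → ℝ) : Prop where
  measurable : Measurable F
  nonneg : 0 ≤ F
  bddAbove : BddAbove (range F)
  integrable : Integrable F

namespace IsBoundedDensity

variable {F G H : ℝ → ℝ}

theorem indicator (hF : IsBoundedDensity F) {S : Set ℝ} (hS : MeasurableSet S) :
    IsBoundedDensity (S.indicator F) where
  measurable := hF.measurable.indicator hS
  nonneg := fun s => indicator_nonneg (fun x _ => hF.nonneg x) s
  bddAbove := by
    obtain ⟨M, hM⟩ := hF.bddAbove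
    refine ⟨M, ?_⟩
    rintro _ ⟨s, rfl⟩
    exact (indicator_le_self' (fun x _ => hF.nonneg x) s).trans (hM ⟨s, rfl⟩)
  integrable := hF.integrable.indicator hS

theorem iSup_pos (hF : IsBoundedDensity F) (h : 0 < ∫ s, F s) : 0 < ⨆ s, F s := by
  by_contra hn
  have : F = 0 := by
    ext s
    exact le_antisymm ((le_ciSup hF.bddAbove s).trans (not_lt.1 hn)) (hF.nonneg s)
  simp [this] at h

/-- The equality case of the Prékopa–Leindler inequality: the suprema agree. -/
theorem iSup_eq (hF : IsBoundedDensity F) (hG : IsBoundedDensity G) (hH : IsBoundedDensity H)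
    (h : ∀ s t, F s ^ (1 / 2 : ℝ) * G t ^ (1 / 2 : ℝ) ≤ H (1 / 2 * s + 1 / 2 * t)) {V : ℝ}
    (hV : 0 < V) (hFV : ∫ s, F s = V) (hGV : ∫ s, G s = V) (hHV : ∫ s, H s ≤ V) :
    ⨆ s, F s = ⨆ s, G s := by
  have hM : 0 < ⨆ s, F s := hF.iSup_pos (hFV ▸ hV)
  have hN : 0 < ⨆ s, G s := hG.iSup_pos (hGV ▸ hV)
  have key := integral_div_iSup_add_le hF.measurable hG.measurable hH.measurable hF.nonneg
    hG.nonneg hH.nonneg hF.bddAbove hG.bddAbove hF.integrable hG.integrable hH.integrable hM hN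
    (l := 1 / 2) (k := 1 / 2) (by norm_num) (by norm_num) (by norm_num) h
  rw [hFV, hGV, ← Real.sqrt_eq_rpow, ← Real.sqrt_eq_rpow] at key
  set M := ⨆ s, F s
  set N := ⨆ s, G s
  have hm : 0 < √M := Real.sqrt_pos.2 hM
  have hn : 0 < √N := Real.sqrt_pos.2 hN
  have key2 : 1 / 2 * (V / M) + 1 / 2 * (V / N) ≤ V / (√M * √N) := key.trans (by gcongr)
  have eM : M = √M * √M := (Real.mul_self_sqrt hM.le).symm
  have eN : N = √N * √N := (Real.mul_self_sqrt hN.le).symm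
  -- The AM–GM defect is a multiple of a square, and `key2` says it is nonpositive.
  have e : 1 / 2 * (V / M) + 1 / 2 * (V / N) - V / (√M * √N) =
      V / 2 * (1 / √M - 1 / √N) ^ 2 := by
    have e1 : V / M = V / (√M * √M) := by rw [← eM]
    have e2 : V / N = V / (√N * √N) := by rw [← eN]
    rw [e1, e2]; field_simp; ring
  have h0 : (1 / √M - 1 / √N) ^ 2 = 0 := by
    by_contra hne
    have : 0 < (1 / √M - 1 / √N) ^ 2 := lt_of_le_of_ne (sq_nonneg _) (Ne.symm hne)
    have : 0 < V / 2 * (1 / √M - 1 / √N) ^ 2 := by positivity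
    linarith
  have h1 : √M = √N := by
    have := sub_eq_zero.1 (pow_eq_zero_iff (two_ne_zero) |>.1 h0)
    field_simp at this
    exact this.symm
  rw [eM, eN, h1]

theorem indicator_rpow_mul_le (hH : 0 ≤ H)
    (h : ∀ s t, F s ^ (1 / 2 : ℝ) * G t ^ (1 / 2 : ℝ) ≤ H (1 / 2 * s + 1 / 2 * t))
    {S T U : Set ℝ} (hSTU : ∀ s ∈ S, ∀ t ∈ T, 1 / 2 * s + 1 / 2 * t ∈ U) (s t : ℝ) :
    S.indicator F s ^ (1 / 2 : ℝ) * T.indicator G t ^ (1 / 2 : ℝ) ≤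
      U.indicator H (1 / 2 * s + 1 / 2 * t) := by
  have h0 : 0 ≤ U.indicator H (1 / 2 * s + 1 / 2 * t) :=
    indicator_nonneg (fun x _ => hH x) _
  by_cases hs : s ∈ S
  · by_cases ht : t ∈ T
    · simpa only [indicator_of_mem hs, indicator_of_mem ht, indicator_of_mem (hSTU s hs t ht)]
        using h s t
    · rw [indicator_of_notMem ht, Real.zero_rpow (by norm_num), mul_zero]; exact h0
  · rw [indicator_of_notMem hs, Real.zero_rpow (by norm_num), zero_mul]; exact h0

theorem setIntegral_le (hF : IsBoundedDensity F) (hG : IsBoundedDensity G)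
    (hH : IsBoundedDensity H)
    (h : ∀ s t, F s ^ (1 / 2 : ℝ) * G t ^ (1 / 2 : ℝ) ≤ H (1 / 2 * s + 1 / 2 * t))
    {S T U : Set ℝ} (hS : MeasurableSet S) (hT : MeasurableSet T) (hU : MeasurableSet U)
    (hSTU : ∀ s ∈ S, ∀ t ∈ T, 1 / 2 * s + 1 / 2 * t ∈ U) {a : ℝ} (ha : 0 < a)
    (hFa : ∫ s in S, F s = a) (hGa : ∫ s in T, G s = a) : a ≤ ∫ s in U, H s := by
  have hF' := hF.indicator hS
  have hG' := hG.indicator hT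
  have hH' := hH.indicator hU
  have := integral_rpow_mul_le hF'.measurable hG'.measurable hH'.measurable hF'.nonneg
    hG'.nonneg hH'.nonneg hF'.bddAbove hG'.bddAbove hF'.integrable hG'.integrable hH'.integrable
    (l := 1 / 2) (k := 1 / 2) (by norm_num) (by norm_num) (by norm_num)
    (indicator_rpow_mul_le hH.nonneg h hSTU)
  rw [integral_indicator hS, integral_indicator hT, integral_indicator hU, hFa, hGa,
    ← Real.rpow_add ha] at this
  norm_num at this
  exact this

theorem setIntegral_Iic_add_Ici (hF : IsBoundedDensity F) (p : ℝ) :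
    (∫ s in Iic p, F s) + ∫ s in Ici p, F s = ∫ s, F s := by
  rw [integral_Ici_eq_integral_Ioi,
    intervalIntegral.integral_Iic_add_Ioi hF.integrable.integrableOn hF.integrable.integrableOn]

/-- In the equality case, if `p` and `q` cut off equal lower masses, then the suprema of the
densities agree on both sides of the cuts. -/
theorem iSup_indicator_eq (hF : IsBoundedDensity F) (hG : IsBoundedDensity G)
    (hH : IsBoundedDensity H)
    (h : ∀ s t, F s ^ (1 / 2 : ℝ) * G t ^ (1 / 2 : ℝ) ≤ H (1 / 2 * s + 1 / 2 * t)) {V : ℝ}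
    (hFV : ∫ s, F s = V) (hGV : ∫ s, G s = V) (hHV : ∫ s, H s = V) {p q τ : ℝ} (hτ : 0 < τ)
    (hτV : τ < V) (hp : ∫ s in Iic p, F s = τ) (hq : ∫ s in Iic q, G s = τ) :
    (⨆ s, (Iic p).indicator F s = ⨆ s, (Iic q).indicator G s) ∧
      ⨆ s, (Ici p).indicator F s = ⨆ s, (Ici q).indicator G s := by
  set m := 1 / 2 * p + 1 / 2 * q with hm
  have h1 : ∀ s ∈ Iic p, ∀ t ∈ Iic q, 1 / 2 * s + 1 / 2 * t ∈ Iic m := by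
    intro s hs t ht
    simp only [mem_Iic] at *
    linarith
  have h2 : ∀ s ∈ Ici p, ∀ t ∈ Ici q, 1 / 2 * s + 1 / 2 * t ∈ Ici m := by
    intro s hs t ht
    simp only [mem_Ici] at *
    linarith
  have hp' : ∫ s in Ici p, F s = V - τ := by linarith [hF.setIntegral_Iic_add_Ici p]
  have hq' : ∫ s in Ici q, G s = V - τ := by linarith [hG.setIntegral_Iic_add_Ici q]
  have hτV' : 0 < V - τ := by linarith
  -- The lower bounds τ and V - τ for the two parts of H add up to its total mass V, so both are
  -- equalities.
  have l1 := setIntegral_le hF hG hH h measurableSet_Iic measurableSet_Iic measurableSet_Iic h1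
    hτ hp hq
  have l2 := setIntegral_le hF hG hH h measurableSet_Ici measurableSet_Ici measurableSet_Ici h2
    hτV' hp' hq'
  have l3 := hH.setIntegral_Iic_add_Ici m
  constructor
  · refine iSup_eq (hF.indicator measurableSet_Iic) (hG.indicator measurableSet_Iic)
      (hH.indicator measurableSet_Iic) (indicator_rpow_mul_le hH.nonneg h h1) hτ ?_ ?_ ?_
    · rw [integral_indicator measurableSet_Iic, hp]
    · rw [integral_indicator measurableSet_Iic, hq]
    · rw [integral_indicator measurableSet_Iic]; linarith
  · refine iSup_eq (hF.indicator measurableSet_Ici) (hG.indicator measurableSet_Ici)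
      (hH.indicator measurableSet_Ici) (indicator_rpow_mul_le hH.nonneg h h2) hτV' ?_ ?_ ?_
    · rw [integral_indicator measurableSet_Ici, hp']
    · rw [integral_indicator measurableSet_Ici, hq']
    · rw [integral_indicator measurableSet_Ici]; linarith

/-- If both one-sided suprema exceeded F p, then p would lie between two points of larger value,
against quasiconcavity. -/
theorem eq_min_iSup_indicator (hF : IsBoundedDensity F) (hq : QuasiconcaveOn ℝ univ F) (p : ℝ) :
    F p = min (⨆ s, (Iic p).indicator F s) (⨆ s, (Ici p).indicator F s) := by
  refine le_antisymm (le_min ?_ ?_) ?_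
  · simpa using le_ciSup (hF.indicator (measurableSet_Iic (a := p))).bddAbove p
  · simpa using le_ciSup (hF.indicator (measurableSet_Ici (a := p))).bddAbove p
  · by_contra hlt
    rw [not_le, lt_min_iff] at hlt
    obtain ⟨s, hs⟩ := exists_lt_of_lt_ciSup hlt.1
    obtain ⟨t, ht⟩ := exists_lt_of_lt_ciSup hlt.2
    have hsp : s ∈ Iic p := by
      by_contra hn
      rw [indicator_of_notMem hn] at hs
      exact absurd (hF.nonneg p) (not_le.2 hs)
    have htp : t ∈ Ici p := by
      by_contra hn
      rw [indicator_of_notMem hn] at ht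
      exact absurd (hF.nonneg p) (not_le.2 ht)
    rw [indicator_of_mem hsp] at hs
    rw [indicator_of_mem htp] at ht
    have hc := (hq.convex_gt (F p)).ordConnected
    exact lt_irrefl _ ((hc.out ⟨mem_univ _, hs⟩ ⟨mem_univ _, ht⟩ ⟨hsp, htp⟩).2)

theorem eq_of_setIntegral_Iic_eq (hF : IsBoundedDensity F) (hG : IsBoundedDensity G)
    (hH : IsBoundedDensity H) (hFq : QuasiconcaveOn ℝ univ F) (hGq : QuasiconcaveOn ℝ univ G)
    (h : ∀ s t, F s ^ (1 / 2 : ℝ) * G t ^ (1 / 2 : ℝ) ≤ H (1 / 2 * s + 1 / 2 * t)) {V : ℝ}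
    (hFV : ∫ s, F s = V) (hGV : ∫ s, G s = V) (hHV : ∫ s, H s = V) {p q τ : ℝ} (hτ : 0 < τ)
    (hτV : τ < V) (hp : ∫ s in Iic p, F s = τ) (hq : ∫ s in Iic q, G s = τ) : F p = G q := by
  obtain ⟨h1, h2⟩ := iSup_indicator_eq hF hG hH h hFV hGV hHV hτ hτV hp hq
  rw [hF.eq_min_iSup_indicator hFq, hG.eq_min_iSup_indicator hGq, h1, h2]

theorem exists_setIntegral_Iic_eq (hF : IsBoundedDensity F) {τ : ℝ} (hτ : 0 < τ)
    (hτV : τ < ∫ s, F s) : ∃ p, ∫ s in Iic p, F s = τ := by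
  have hsub : ∀ p, ∫ s in Iic p, F s = (∫ s in Iic 0, F s) - ∫ s in p..0, F s := fun p => by
    rw [← intervalIntegral.integral_Iic_sub_Iic hF.integrable.integrableOn
      hF.integrable.integrableOn, sub_sub_cancel]
  have hc : Continuous fun p => ∫ s in Iic p, F s := by
    have : (fun p => ∫ s in Iic p, F s) = fun p => (∫ s in Iic 0, F s) + ∫ s in (0 : ℝ)..p, F s :=
      funext fun p => by rw [hsub, intervalIntegral.integral_symm 0 p, sub_neg_eq_add]
    rw [this]
    exact continuous_const.add (hF.integrable.continuous_primitive 0)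
  have hbot : Tendsto (fun p => ∫ s in Iic p, F s) atBot (𝓝 0) := by
    have := (tendsto_const_nhds (x := ∫ s in Iic 0, F s)).sub
      (intervalIntegral_tendsto_integral_Iic 0 hF.integrable.integrableOn tendsto_id)
    rw [sub_self] at this
    exact this.congr fun p => (hsub p).symm
  have htop : Tendsto (fun p => ∫ s in Iic p, F s) atTop (𝓝 (∫ s, F s)) :=
    (aecover_Iic tendsto_id).integral_tendsto_of_countably_generated hF.integrable
  obtain ⟨a, ha⟩ := (hbot.eventually_lt_const hτ).exists
  obtain ⟨b, hb⟩ := (htop.eventually_const_lt hτV).exists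
  obtain ⟨p, hp⟩ := intermediate_value_univ a b hc ⟨ha.le, hb.le⟩
  exact ⟨p, hp⟩

section Quantile

variable {z : ℝ → ℝ} {V : ℝ}

theorem setIntegral_Iic_mono (hF : IsBoundedDensity F) : Monotone fun p => ∫ s in Iic p, F s :=
  fun _ _ h => setIntegral_mono_set hF.integrable.integrableOn (ae_of_all _ hF.nonneg)
    (Iic_subset_Iic.2 h).eventuallyLE

theorem strictMonoOn_quantile (hF : IsBoundedDensity F)
    (hz : ∀ τ ∈ Ioo 0 V, ∫ s in Iic (z τ), F s = τ) : StrictMonoOn z (Ioo 0 V) := by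
  intro τ hτ τ' hτ' hlt
  by_contra hn
  have := hF.setIntegral_Iic_mono (not_lt.1 hn)
  simp only [hz τ hτ, hz τ' hτ'] at this
  linarith

/-- It suffices to compare half-lines: {τ | z τ ≤ a} lies between (0, Φ) and (0, Φ], where Φ is the
mass of F up to a. -/
theorem map_quantile (hF : IsBoundedDensity F) (hV : ∫ s, F s = V)
    (hz : ∀ τ ∈ Ioo 0 V, ∫ s in Iic (z τ), F s = τ) :
    (volume.restrict (Ioo 0 V)).map z = volume.withDensity fun s => ENNReal.ofReal (F s) := by
  have hmono := hF.strictMonoOn_quantile hz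
  have hzm : AEMeasurable z (volume.restrict (Ioo 0 V)) :=
    aemeasurable_restrict_of_monotoneOn measurableSet_Ioo hmono.monotoneOn
  refine Measure.ext_of_Iic _ _ fun a => ?_
  rw [Measure.map_apply_of_aemeasurable hzm measurableSet_Iic,
    Measure.restrict_apply' measurableSet_Ioo, withDensity_apply _ measurableSet_Iic,
    ← ofReal_integral_eq_lintegral_ofReal hF.integrable.integrableOn (ae_of_all _ hF.nonneg)]
  set Φ := ∫ s in Iic a, F s with hΦ
  have hΦV : Φ ≤ V := by
    rw [← hV]; exact setIntegral_le_integral hF.integrable (ae_of_all _ hF.nonneg)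
  refine le_antisymm ?_ ?_
  · calc volume (z ⁻¹' Iic a ∩ Ioo 0 V) ≤ volume (Ioc 0 Φ) := by
          refine measure_mono ?_
          rintro τ ⟨h1, h2⟩
          refine ⟨h2.1, ?_⟩
          have := hF.setIntegral_Iic_mono h1
          simp only [hz τ h2] at this
          exact this
      _ = ENNReal.ofReal Φ := by simp
  · calc ENNReal.ofReal Φ = volume (Ioo 0 Φ) := by simp
      _ ≤ volume (z ⁻¹' Iic a ∩ Ioo 0 V) := by
          refine measure_mono fun τ hτ => ?_
          have hτ' : τ ∈ Ioo 0 V := ⟨hτ.1, hτ.2.trans_le hΦV⟩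
          refine ⟨?_, hτ'⟩
          by_contra hn
          have := hF.setIntegral_Iic_mono (not_le.1 hn).le
          simp only [hz τ hτ', ← hΦ] at this
          linarith [hτ.2]

/-- The masses left of z τ and right of z τ' are positive, so F is positive somewhere on each side,
hence in between. -/
theorem pos_of_mem_Icc_quantile (hF : IsBoundedDensity F) (hq : QuasiconcaveOn ℝ univ F)
    (hV : ∫ s, F s = V) (hz : ∀ τ ∈ Ioo 0 V, ∫ s in Iic (z τ), F s = τ) {τ τ' : ℝ}
    (hτ : τ ∈ Ioo 0 V) (hτ' : τ' ∈ Ioo 0 V) {p : ℝ} (hp : p ∈ Icc (z τ) (z τ')) : 0 < F p := by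
  have h1 : ∃ s ∈ Iic (z τ), 0 < F s := by
    by_contra! hn
    have := setIntegral_nonpos (μ := volume) measurableSet_Iic hn
    linarith [hz τ hτ, hτ.1]
  have h2 : ∃ s ∈ Ici (z τ'), 0 < F s := by
    by_contra! hn
    have := setIntegral_nonpos (μ := volume) measurableSet_Ici hn
    linarith [hz τ' hτ', hτ'.2, hF.setIntegral_Iic_add_Ici (z τ')]
  obtain ⟨s, hs, hs'⟩ := h1
  obtain ⟨t, ht, ht'⟩ := h2
  exact ((hq.convex_gt 0).ordConnected.out ⟨mem_univ _, hs'⟩ ⟨mem_univ _, ht'⟩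
    ⟨le_trans hs hp.1, hp.2.trans ht⟩).2

/-- The integrated form of z' = 1 / F(z): write length as the integral of 1 / F against F dx and
pull back along z. -/
theorem ofReal_quantile_sub (hF : IsBoundedDensity F) (hq : QuasiconcaveOn ℝ univ F)
    (hV : ∫ s, F s = V) (hz : ∀ τ ∈ Ioo 0 V, ∫ s in Iic (z τ), F s = τ) {τ τ' : ℝ}
    (hτ : τ ∈ Ioo 0 V) (hτ' : τ' ∈ Ioo 0 V) :
    ENNReal.ofReal (z τ' - z τ) = ∫⁻ x in Ioc τ τ', (ENNReal.ofReal (F (z x)))⁻¹ := by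
  have hmono := hF.strictMonoOn_quantile hz
  have hzm : AEMeasurable z (volume.restrict (Ioo 0 V)) :=
    aemeasurable_restrict_of_monotoneOn measurableSet_Ioo hmono.monotoneOn
  have hFm : Measurable fun s => ENNReal.ofReal (F s) := hF.measurable.ennreal_ofReal
  have hsub : Ioc τ τ' ⊆ Ioo 0 V := fun x hx => ⟨hτ.1.trans hx.1, hx.2.trans_lt hτ'.2⟩
  calc ENNReal.ofReal (z τ' - z τ) = ∫⁻ x in Ioc (z τ) (z τ'), 1 := by simp
    _ = ∫⁻ x in Ioc (z τ) (z τ'),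
          ((fun s => ENNReal.ofReal (F s)) * fun s => (ENNReal.ofReal (F s))⁻¹) x := by
        refine setLIntegral_congr_fun measurableSet_Ioc fun x hx => ?_
        have := hF.pos_of_mem_Icc_quantile hq hV hz hτ hτ' (Ioc_subset_Icc_self hx)
        exact (ENNReal.mul_inv_cancel (by simpa using this) ENNReal.ofReal_ne_top).symm
    _ = ∫⁻ x in Ioc (z τ) (z τ'), (ENNReal.ofReal (F x))⁻¹
          ∂(volume.withDensity fun s => ENNReal.ofReal (F s)) :=
        (setLIntegral_withDensity_eq_setLIntegral_mul _ hFm hFm.inv measurableSet_Ioc).symm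
    _ = ∫⁻ x in Ioo 0 V,
          (Ioc (z τ) (z τ')).indicator (fun s => (ENNReal.ofReal (F s))⁻¹) (z x) := by
        rw [← lintegral_indicator measurableSet_Ioc, ← hF.map_quantile hV hz]
        exact lintegral_map' (hFm.inv.indicator measurableSet_Ioc).aemeasurable hzm
    _ = ∫⁻ x in Ioo 0 V,
          (Ioc τ τ').indicator (fun x => (ENNReal.ofReal (F (z x)))⁻¹) x := by
        refine setLIntegral_congr_fun measurableSet_Ioo fun x hx => ?_
        have : z x ∈ Ioc (z τ) (z τ') ↔ x ∈ Ioc τ τ' := by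
          simp only [mem_Ioc, hmono.lt_iff_lt hτ hx, hmono.le_iff_le hx hτ']
        by_cases hx' : x ∈ Ioc τ τ'
        · simp only [indicator_of_mem hx', indicator_of_mem (this.2 hx')]
        · simp only [indicator_of_notMem hx', indicator_of_notMem (fun h => hx' (this.1 h))]
    _ = _ := by
        rw [lintegral_indicator measurableSet_Ioc, Measure.restrict_restrict measurableSet_Ioc,
          inter_eq_self_of_subset_left hsub]

end Quantile

/-- The equality case of the Prékopa–Leindler inequality on the line for quasiconcave densities of
equal mass: they are translates of each other. -/
theorem exists_withDensity_eq_map (hF : IsBoundedDensity F) (hG : IsBoundedDensity G)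
    (hH : IsBoundedDensity H) (hFq : QuasiconcaveOn ℝ univ F) (hGq : QuasiconcaveOn ℝ univ G)
    (h : ∀ s t, F s ^ (1 / 2 : ℝ) * G t ^ (1 / 2 : ℝ) ≤ H (1 / 2 * s + 1 / 2 * t)) {V : ℝ}
    (hV : 0 < V) (hFV : ∫ s, F s = V) (hGV : ∫ s, G s = V) (hHV : ∫ s, H s = V) :
    ∃ d : ℝ, (volume.withDensity fun s => ENNReal.ofReal (G s)) =
      (volume.withDensity fun s => ENNReal.ofReal (F s)).map (· + d) := by
  choose! z hz using fun τ (hτ : τ ∈ Ioo 0 V) =>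
    hF.exists_setIntegral_Iic_eq hτ.1 (hFV ▸ hτ.2)
  choose! y hy using fun τ (hτ : τ ∈ Ioo 0 V) =>
    hG.exists_setIntegral_Iic_eq hτ.1 (hGV ▸ hτ.2)
  have hzmono := hF.strictMonoOn_quantile hz
  have hymono := hG.strictMonoOn_quantile hy
  -- The densities agree at matching quantiles, so both quantile functions have the same increments.
  have key : ∀ τ ∈ Ioo 0 V, ∀ τ' ∈ Ioo 0 V, τ ≤ τ' → z τ' - z τ = y τ' - y τ := by
    intro τ hτ τ' hτ' hle
    have h1 : 0 ≤ z τ' - z τ := sub_nonneg.2 (hzmono.monotoneOn hτ hτ' hle)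
    have h2 : 0 ≤ y τ' - y τ := sub_nonneg.2 (hymono.monotoneOn hτ hτ' hle)
    rw [← ENNReal.ofReal_eq_ofReal_iff h1 h2, hF.ofReal_quantile_sub hFq hFV hz hτ hτ',
      hG.ofReal_quantile_sub hGq hGV hy hτ hτ']
    refine setLIntegral_congr_fun measurableSet_Ioc fun x hx => ?_
    have hx' : x ∈ Ioo 0 V := ⟨hτ.1.trans hx.1, hx.2.trans_lt hτ'.2⟩
    simp only [eq_of_setIntegral_Iic_eq hF hG hH hFq hGq h hFV hGV hHV hx'.1 hx'.2 (hz x hx')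
      (hy x hx')]
  have hhalf : V / 2 ∈ Ioo 0 V := ⟨by linarith, by linarith⟩
  -- The shift is the difference of the medians.
  refine ⟨y (V / 2) - z (V / 2), ?_⟩
  rw [← hF.map_quantile hFV hz, ← hG.map_quantile hGV hy, AEMeasurable.map_map_of_aemeasurable
    (by fun_prop) (aemeasurable_restrict_of_monotoneOn measurableSet_Ioo hzmono.monotoneOn)]
  refine Measure.map_congr ?_
  filter_upwards [ae_restrict_mem measurableSet_Ioo] with τ hτ
  rcases le_total τ (V / 2) with hle | hle
  · have := key τ hτ _ hhalf hle
    simp only [Function.comp_apply]; linarith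
  · have := key _ hhalf τ hτ hle
    simp only [Function.comp_apply]; linarith

end IsBoundedDensity

/-! ### Marginals of convex bodies -/

section

variable {Y : Type*} [NormedAddCommGroup Y] [MeasurableSpace Y] [BorelSpace Y]
  [SecondCountableTopology Y] {A : Set (ℝ × Y)}

theorem isBoundedDensity_sectionVol (ν : Measure Y) [SFinite ν]
    [IsFiniteMeasureOnCompacts ν] (hA : IsCompact A) : IsBoundedDensity (sectionVol ν A) where
  measurable := measurable_sectionVol ν hA
  nonneg := sectionVol_nonneg ν A
  bddAbove := bddAbove_range_sectionVol ν hA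
  integrable := integrable_sectionVol ν hA

theorem withDensity_sectionVol (ν : Measure Y) [SFinite ν]
    [IsFiniteMeasureOnCompacts ν] (hA : IsCompact A) :
    (volume.withDensity fun s => ENNReal.ofReal (sectionVol ν A s)) =
      ((volume.prod ν).restrict A).map Prod.fst := by
  ext T hT
  rw [withDensity_apply _ hT, lintegral_ofReal_sectionVol ν hA hT, Measure.map_apply
    measurable_fst hT, Measure.restrict_apply (measurable_fst hT), inter_comm]

end

namespace IsBrunnMinkowski

variable {Y : Type*} [NormedAddCommGroup Y] [NormedSpace ℝ Y] [MeasurableSpace Y] [BorelSpace Y]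
  [SecondCountableTopology Y] {ν : Measure Y} {A B C : Set (ℝ × Y)}

/-- Brunn–Minkowski for sections, with all three sets equal to A. -/
theorem quasiconcaveOn_sectionVol (h : IsBrunnMinkowski ν) (hA : IsCompact A)
    (hAc : Convex ℝ A) : QuasiconcaveOn ℝ univ (sectionVol ν A) := by
  intro r
  rw [convex_iff_forall_pos]
  rintro s ⟨-, hs⟩ t ⟨-, ht⟩ l k hl hk hlk
  refine ⟨mem_univ _, ?_⟩
  rcases le_or_gt r 0 with hr | hr
  · exact hr.trans (sectionVol_nonneg ν A _)
  · calc r = r ^ l * r ^ k := by rw [← Real.rpow_add hr, hlk, Real.rpow_one]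
      _ ≤ sectionVol ν A s ^ l * sectionVol ν A t ^ k := by
        have : 0 ≤ sectionVol ν A s := sectionVol_nonneg ν A s
        gcongr
      _ ≤ _ := h.sectionVol_le hA hA hA hl hk hlk
        (fun a ha b hb => hAc ha hb hl.le hk.le hlk) s t

variable [SFinite ν] [IsFiniteMeasureOnCompacts ν]

theorem exists_map_fst_eq (h : IsBrunnMinkowski ν) (hA : IsCompact A) (hB : IsCompact B)
    (hC : IsCompact C) (hAc : Convex ℝ A) (hBc : Convex ℝ B)
    (hABC : ∀ a ∈ A, ∀ b ∈ B, (1 / 2 : ℝ) • a + (1 / 2 : ℝ) • b ∈ C)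
    (hA0 : 0 < (volume.prod ν).real A) (hBA : (volume.prod ν).real B = (volume.prod ν).real A)
    (hCA : (volume.prod ν).real C = (volume.prod ν).real A) :
    ∃ d : ℝ, ((volume.prod ν).restrict B).map Prod.fst =
      (((volume.prod ν).restrict A).map Prod.fst).map (· + d) := by
  rw [← withDensity_sectionVol ν hA, ← withDensity_sectionVol ν hB]
  exact (isBoundedDensity_sectionVol ν hA).exists_withDensity_eq_map
    (isBoundedDensity_sectionVol ν hB) (isBoundedDensity_sectionVol ν hC)
    (h.quasiconcaveOn_sectionVol hA hAc) (h.quasiconcaveOn_sectionVol hB hBc)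
    (h.sectionVol_le hA hB hC (by norm_num) (by norm_num) (by norm_num) hABC) hA0
    (integral_sectionVol ν hA) ((integral_sectionVol ν hB).trans hBA)
    ((integral_sectionVol ν hC).trans hCA)

end IsBrunnMinkowski

/-! ### Equality in Brunn–Minkowski -/

section

variable {E : Type*} [NormedAddCommGroup E] [NormedSpace ℝ E] [FiniteDimensional ℝ E]

/-- Complete u by coordinates on its kernel, extended linearly to E. -/
theorem exists_continuousLinearEquiv_fst_eq (u : E →L[ℝ] ℝ) (hu : u ≠ 0) :
    ∃ (m : ℕ) (e : E ≃L[ℝ] ℝ × (Fin m → ℝ)), ∀ x, (e x).1 = u x := by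
  have hu' : (u : E →ₗ[ℝ] ℝ) ≠ 0 := by
    exact fun h => hu (ContinuousLinearMap.coe_injective h)
  have hdim := Module.Dual.finrank_ker_add_one_of_ne_zero hu'
  set N := LinearMap.ker (u : E →ₗ[ℝ] ℝ)
  let φ : N ≃ₗ[ℝ] (Fin (Module.finrank ℝ N) → ℝ) := LinearEquiv.ofFinrankEq _ _ (by simp)
  obtain ⟨g, hg⟩ := φ.toLinearMap.exists_extend
  let L : E →ₗ[ℝ] ℝ × (Fin (Module.finrank ℝ N) → ℝ) := (u : E →ₗ[ℝ] ℝ).prod g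
  have hL : Function.Injective L := by
    rw [← LinearMap.ker_eq_bot, LinearMap.ker_eq_bot']
    intro x hx
    have h1 : u x = 0 := congrArg Prod.fst hx
    have h2 : g x = 0 := congrArg Prod.snd hx
    have h3 : φ ⟨x, h1⟩ = 0 := by
      rw [← h2]
      exact (LinearMap.congr_fun hg ⟨x, h1⟩).symm
    simpa using congrArg Subtype.val (φ.map_eq_zero_iff.1 h3)
  refine ⟨_, (LinearEquiv.ofInjectiveOfFinrankEq L hL ?_).toContinuousLinearEquiv, fun x => rfl⟩
  simp [← hdim, add_comm]

variable [MeasurableSpace E] [BorelSpace E] (μ : Measure E) [μ.IsAddHaarMeasure]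
  {A B C : Set E}

/-- In coordinates starting with u, μ is a product measure up to a scalar, which cancels. -/
theorem exists_map_restrict_eq (hA : IsCompact A) (hB : IsCompact B)
    (hC : IsCompact C) (hAc : Convex ℝ A) (hBc : Convex ℝ B)
    (hABC : ∀ a ∈ A, ∀ b ∈ B, (1 / 2 : ℝ) • a + (1 / 2 : ℝ) • b ∈ C)
    (hA0 : 0 < μ A) (hBA : μ B = μ A) (hCA : μ C = μ A) (u : E →L[ℝ] ℝ) :
    ∃ d : ℝ, (μ.restrict B).map u = ((μ.restrict A).map u).map (· + d) := by
  by_cases hu : u = 0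
  · refine ⟨0, ?_⟩
    subst hu
    simp only [add_zero, Measure.map_id']
    have : (⇑(0 : E →L[ℝ] ℝ)) = fun _ => 0 := rfl
    rw [this, Measure.map_const, Measure.map_const]
    simp [hBA]
  obtain ⟨m, e, he⟩ := exists_continuousLinearEquiv_fst_eq u hu
  let ρ : Measure (ℝ × (Fin m → ℝ)) := volume.prod volume
  have : (ρ.map e.symm).IsAddHaarMeasure := e.symm.isAddHaarMeasure_map ρ
  set c := (ρ.map e.symm).addHaarScalarFactor μ
  have hρ : ρ.map e.symm = c • μ := Measure.isAddLeftInvariant_eq_smul _ _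
  have hc : c ≠ 0 := (Measure.addHaarScalarFactor_pos_of_isAddHaarMeasure _ _).ne'
  have hem : Measurable e.symm := e.symm.continuous.measurable
  have hval : ∀ {S : Set E}, IsCompact S → ρ.real (e.symm ⁻¹' S) = c * μ.real S := by
    intro S hS
    rw [measureReal_def, ← Measure.map_apply hem hS.measurableSet, hρ]
    simp [measureReal_def]
  have hmap : ∀ {S : Set E}, IsCompact S →
      (ρ.restrict (e.symm ⁻¹' S)).map Prod.fst = c • (μ.restrict S).map u := by
    intro S hS
    rw [← Measure.map_smul, ← Measure.restrict_smul, ← hρ, Measure.restrict_map hem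
      hS.measurableSet, Measure.map_map u.continuous.measurable hem]
    congr 1
    ext y
    simp [← he]
  have hcomp : ∀ {S : Set E}, IsCompact S → IsCompact (e.symm ⁻¹' S) := fun hS =>
    e.symm.toHomeomorph.isCompact_preimage.2 hS
  have hconv : ∀ {S : Set E}, Convex ℝ S → Convex ℝ (e.symm ⁻¹' S) := fun hS =>
    hS.linear_preimage e.symm.toLinearEquiv.toLinearMap
  obtain ⟨d, hd⟩ := (isBrunnMinkowski_volume_pi m).exists_map_fst_eq (hcomp hA) (hcomp hB)
    (hcomp hC) (hconv hAc) (hconv hBc)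
    (fun a ha b hb => by simpa using hABC _ ha _ hb)
    (by
      rw [hval hA]
      exact mul_pos (by positivity) (ENNReal.toReal_pos hA0.ne' hA.measure_lt_top.ne))
    (by rw [hval hA, hval hB, measureReal_def, hBA, measureReal_def])
    (by rw [hval hA, hval hC, measureReal_def, hCA, measureReal_def])
  refine ⟨d, ?_⟩
  change (ρ.restrict _).map _ = ((ρ.restrict _).map _).map _ at hd
  rw [hmap hA, hmap hB, Measure.map_smul] at hd
  have := congrArg (fun m => c⁻¹ • m) hd
  simpa [smul_smul, inv_mul_cancel₀ hc] using this

variable {μ}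

theorem nonempty_interior_of_measure_pos (hA : Convex ℝ A) (h : 0 < μ A) :
    (interior A).Nonempty := by
  by_contra hn
  rw [not_nonempty_iff_eq_empty] at hn
  have h1 : A ⊆ frontier A := by
    rw [frontier, hn, sdiff_empty]; exact subset_closure
  exact h.ne' (measure_mono_null h1 (hA.addHaar_frontier μ))

/-- `interior B \ A` is open and null, hence empty, and B lies in the closure of its interior. -/
theorem eq_of_subset_of_measure_eq (hA : IsClosed A) (hB : Convex ℝ B)
    (hAB : A ⊆ B) (hfin : μ B ≠ ⊤) (hpos : 0 < μ B) (h : μ A = μ B) : A = B := by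
  refine hAB.antisymm ?_
  have h0 : μ (B \ A) = 0 := by
    rw [measure_sdiff hAB hA.measurableSet.nullMeasurableSet (h ▸ hfin), h, tsub_self]
  have h1 : interior B ⊆ A := by
    have ho : IsOpen (interior B \ A) := isOpen_interior.sdiff hA
    have := (ho.measure_eq_zero_iff μ).1
      (measure_mono_null (sdiff_subset_sdiff_left interior_subset) h0)
    exact sdiff_eq_empty.1 this
  calc B ⊆ closure B := subset_closure
    _ = closure (interior B) := (hB.closure_interior_eq_closure_of_nonempty_interior
        (nonempty_interior_of_measure_pos hB hpos)).symm
    _ ⊆ A := closure_minimal h1 hA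

/-- The equality case of the Brunn–Minkowski inequality for convex bodies of equal volume. -/
theorem exists_eq_image_add (hA : IsCompact A) (hB : IsCompact B)
    (hC : IsCompact C) (hAc : Convex ℝ A) (hBc : Convex ℝ B)
    (hABC : ∀ a ∈ A, ∀ b ∈ B, (1 / 2 : ℝ) • a + (1 / 2 : ℝ) • b ∈ C)
    (hA0 : 0 < μ A) (hBA : μ B = μ A) (hCA : μ C = μ A) :
    ∃ c : E, (fun x => x + c) '' A = B := by
  have hAr : 0 < μ.real A := ENNReal.toReal_pos hA0.ne' hA.measure_lt_top.ne
  -- The difference of the centroids; comparing first moments of the marginals identifies every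
  -- shift d as u c.
  let c : E := (μ.real A)⁻¹ • ((∫ x in B, x ∂μ) - ∫ x in A, x ∂μ)
  have hid : ∀ {S : Set E}, IsCompact S → IntegrableOn (fun x : E => x) S μ := fun hS =>
    continuous_id.continuousOn.integrableOn_compact hS
  have hu : ∀ u : E →L[ℝ] ℝ,
      (μ.restrict B).map u = ((μ.restrict A).map u).map (· + u c) := by
    intro u
    obtain ⟨d, hd⟩ := exists_map_restrict_eq μ hA hB hC hAc hBc hABC hA0 hBA hCA u
    suffices d = u c by rw [← this]; exact hd
    have hum := u.continuous.measurable
    have h1 : ∫ x, u x ∂(μ.restrict B) = ∫ x, (u x + d) ∂(μ.restrict A) := by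
      have e1 : ∫ y, y ∂((μ.restrict B).map u) = ∫ x, u x ∂(μ.restrict B) :=
        integral_map hum.aemeasurable aestronglyMeasurable_id
      have e2 : ∫ y, y ∂(((μ.restrict A).map u).map (· + d)) =
          ∫ y, (y + d) ∂((μ.restrict A).map u) :=
        integral_map (by fun_prop) aestronglyMeasurable_id
      rw [← e1, hd, e2, integral_map hum.aemeasurable (by fun_prop)]
    have hi : IntegrableOn (fun x => u x) A μ := u.integrable_comp (hid hA)
    rw [integral_add hi (by
      have : IsFiniteMeasure (μ.restrict A) := ⟨by simpa using hA.measure_lt_top⟩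
      exact integrable_const d)] at h1
    rw [u.integral_comp_comm (hid hA), u.integral_comp_comm (hid hB), integral_const] at h1
    simp only [c, map_smul, map_sub, smul_eq_mul]
    rw [measureReal_restrict_apply_univ, smul_eq_mul] at h1
    rw [h1]
    field_simp
    ring
  refine ⟨c, ?_⟩
  have hcl : IsCompact ((fun x => x + c) '' A) := hA.image (by fun_prop)
  refine eq_of_subset_of_measure_eq (μ := μ) hcl.isClosed hBc ?_
    hB.measure_lt_top.ne (hBA ▸ hA0) (by
      rw [image_add_right, measure_preimage_add_right, hBA])
  rintro _ ⟨x, hx, rfl⟩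
  by_contra hxB
  -- The f-marginal of B has no mass above s, but that of A + c does, since interior points of A lie
  -- near x.
  obtain ⟨f, s, hf1, hf2⟩ := geometric_hahn_banach_closed_point hBc hB.isClosed hxB
  have hfm := f.continuous.measurable
  have h0 : (μ.restrict B).map f (Ioi s) = 0 := by
    rw [Measure.map_apply hfm measurableSet_Ioi, Measure.restrict_apply (hfm measurableSet_Ioi)]
    convert measure_empty (μ := μ)
    ext y
    simp only [mem_inter_iff, mem_preimage, mem_Ioi, mem_empty_iff_false, iff_false, not_and]
    intro h1 h2
    exact lt_asymm h1 (hf1 y h2)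
  have hopen : IsOpen {y | s < f (y + c)} := isOpen_lt continuous_const (by fun_prop)
  rw [hu f, Measure.map_apply (by fun_prop) measurableSet_Ioi,
    Measure.map_apply hfm ((measurable_add_const _) measurableSet_Ioi),
    Measure.restrict_apply (hfm ((measurable_add_const _) measurableSet_Ioi))] at h0
  have hxcl : x ∈ closure (interior A) := by
    rw [hAc.closure_interior_eq_closure_of_nonempty_interior
      (nonempty_interior_of_measure_pos hAc hA0)]
    exact subset_closure hx
  obtain ⟨y, hy1, hy2⟩ := mem_closure_iff.1 hxcl _ hopen hf2
  have hpos := (hopen.inter isOpen_interior).measure_pos μ ⟨y, hy1, hy2⟩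
  refine hpos.ne' (measure_mono_null ?_ h0)
  rintro z ⟨hz1, hz2⟩
  refine ⟨?_, interior_subset hz2⟩
  simpa [sub_lt_iff_lt_add] using hz1

end

/-! ### Recession directions and compactness -/

section

variable {E : Type*} [NormedAddCommGroup E] [NormedSpace ℝ E]

/-- A closed convex set containing points tending to infinity in the direction `z` recedes in
that direction. -/
theorem add_smul_mem_of_tendsto_direction {K : Set E} (hK : IsClosed K) (hKc : Convex ℝ K)
    {x : ℕ → E} (hx : ∀ i, x i ∈ K) (hn : Tendsto (fun i => ‖x i‖) atTop atTop) {z : E}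
    (hz : Tendsto (fun i => ‖x i‖⁻¹ • x i) atTop (𝓝 z)) {p : E} (hp : p ∈ K) {r : ℝ}
    (hr : 0 ≤ r) : p + r • z ∈ K := by
  have hinv : Tendsto (fun i => ‖x i‖⁻¹) atTop (𝓝 0) := tendsto_inv_atTop_zero.comp hn
  -- These approximants are p + (r/‖x i‖)(x i - p), eventually convex combinations of p and x i.
  have ht : Tendsto (fun i => p + r • (‖x i‖⁻¹ • x i - ‖x i‖⁻¹ • p)) atTop
      (𝓝 (p + r • (z - (0 : ℝ) • p))) :=
    tendsto_const_nhds.add ((hz.sub (hinv.smul_const p)).const_smul r)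
  rw [zero_smul, sub_zero] at ht
  refine hK.mem_of_tendsto ht ?_
  filter_upwards [hn.eventually_ge_atTop (max r 1)] with i hi
  have h1 : 0 < ‖x i‖ := one_pos.trans_le ((le_max_right _ _).trans hi)
  have h2 : r * ‖x i‖⁻¹ ≤ 1 := by
    rw [← div_eq_mul_inv, div_le_one h1]; exact (le_max_left _ _).trans hi
  have : p + r • (‖x i‖⁻¹ • x i - ‖x i‖⁻¹ • p) = p + (r * ‖x i‖⁻¹) • (x i - p) := by
    module
  rw [this]
  exact hKc.add_smul_sub_mem hp (hx i) ⟨by positivity, h2⟩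

variable [FiniteDimensional ℝ E]

theorem exists_direction_of_not_isBounded {S : Set E} (hS : ¬ Bornology.IsBounded S) :
    ∃ (x : ℕ → E) (z : E), z ≠ 0 ∧ (∀ i, x i ∈ S) ∧ Tendsto (fun i => ‖x i‖) atTop atTop ∧
      Tendsto (fun i => ‖x i‖⁻¹ • x i) atTop (𝓝 z) := by
  have h : ∀ i : ℕ, ∃ x ∈ S, (i : ℝ) + 1 < ‖x‖ := by
    intro i
    by_contra! hn
    exact hS (isBounded_iff_forall_norm_le.2 ⟨_, hn⟩)
  choose x hx hi using h
  have hn : Tendsto (fun i => ‖x i‖) atTop atTop :=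
    tendsto_atTop_mono (fun i => by linarith [hi i]) tendsto_natCast_atTop_atTop
  have hs : ∀ i, ‖x i‖⁻¹ • x i ∈ Metric.sphere (0 : E) 1 := by
    intro i
    have : 0 < ‖x i‖ := by
      have : (0 : ℝ) ≤ i := i.cast_nonneg
      linarith [hi i]
    simp [norm_smul, this.ne']
  obtain ⟨z, hz, φ, hφ, ht⟩ := (isCompact_sphere (0 : E) 1).tendsto_subseq hs
  refine ⟨x ∘ φ, z, ?_, fun i => hx _, hn.comp hφ.tendsto_atTop, ht⟩
  rintro rfl
  simp at hz

variable [MeasurableSpace E] [BorelSpace E] {μ : Measure E} [μ.IsAddHaarMeasure]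

theorem measure_eq_top_of_add_smul_mem {S : Set E} (hS : (interior S).Nonempty) {z : E}
    (hz : z ≠ 0) (h : ∀ x ∈ S, ∀ r : ℝ, 0 ≤ r → x + r • z ∈ S) : μ S = ⊤ := by
  obtain ⟨c, hc⟩ := hS
  obtain ⟨ε, hε, hball⟩ := Metric.isOpen_iff.1 isOpen_interior c hc
  have hz0 : 0 < ‖z‖ := norm_pos_iff.2 hz
  -- Steps of length 2ε along z make the translated balls of radius ε disjoint.
  let R : ℝ := 2 * ε / ‖z‖
  have hR : 0 < R := by positivity
  let b : ℕ → Set E := fun i => Metric.ball (c + (i * R) • z) ε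
  have hb : ∀ i, b i ⊆ S := by
    intro i x hx
    have h1 : x - (i * R) • z ∈ S := by
      refine interior_subset (hball ?_)
      rw [Metric.mem_ball, dist_eq_norm] at hx ⊢
      convert hx using 2
      abel
    simpa using h _ h1 (i * R) (by positivity)
  have hd : Pairwise (Function.onFun Disjoint b) := by
    intro i j hij
    refine Metric.ball_disjoint_ball ?_
    rw [dist_eq_norm, show c + (i * R) • z - (c + (j * R) • z) = (((i : ℝ) - j) * R) • z by module,
      norm_smul, norm_mul, Real.norm_of_nonneg hR.le]
    have h1 : (1 : ℝ) ≤ ‖(i : ℝ) - j‖ := by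
      have : (1 : ℤ) ≤ |(i : ℤ) - j| := Int.one_le_abs (sub_ne_zero.2 (by exact_mod_cast hij))
      rw [Real.norm_eq_abs]
      exact_mod_cast this
    calc ε + ε = 1 * R * ‖z‖ := by simp only [R]; field_simp; ring
      _ ≤ _ := by gcongr
  refine eq_top_iff.2 ?_
  calc ⊤ = ∑' _ : ℕ, μ (Metric.ball c ε) :=
        (ENNReal.tsum_const_eq_top_of_ne_zero (Metric.measure_ball_pos μ c hε).ne').symm
    _ = ∑' i, μ (b i) := by
        congr with i
        rw [Measure.addHaar_ball_center, Measure.addHaar_ball_center μ (c + _)]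
    _ = μ (⋃ i, b i) := (measure_iUnion hd fun i => measurableSet_ball).symm
    _ ≤ μ S := measure_mono (iUnion_subset hb)

/-- If one translate of `L` meets `K` in a set of positive finite measure, then every translate
of `L` meets `K` in a bounded set. -/
theorem isCompact_inter_image_add {K L : Set E} (hK : IsClosed K) (hKc : Convex ℝ K)
    (hL : IsClosed L) (hLc : Convex ℝ L) {b : E} (hpos : 0 < μ (K ∩ (fun y => y + b) '' L))
    (hfin : μ (K ∩ (fun y => y + b) '' L) < ⊤) (a : E) :
    IsCompact (K ∩ (fun y => y + a) '' L) := by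
  have hcl : ∀ c : E, IsClosed ((fun y => y + c) '' L) := fun c =>
    (Homeomorph.addRight c).isClosed_image.2 hL
  have hcv : ∀ c : E, Convex ℝ ((fun y => y + c) '' L) := fun c => by
    simpa [image_add_right, add_comm] using hLc.translate c
  refine Metric.isCompact_of_isClosed_isBounded (hK.inter (hcl a)) ?_
  by_contra hb
  obtain ⟨x, z, hz, hx, hn, ht⟩ := exists_direction_of_not_isBounded hb
  -- Recession directions of L do not depend on the translate, so z also recedes in the intersection
  -- at b.
  refine hfin.ne (measure_eq_top_of_add_smul_mem
    (nonempty_interior_of_measure_pos (hKc.inter (hcv b)) hpos) hz ?_)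
  rintro p ⟨hp1, q, hq, rfl⟩ r hr
  refine ⟨add_smul_mem_of_tendsto_direction hK hKc (fun i => (hx i).1) hn ht hp1 hr, ?_⟩
  obtain ⟨y, hy, hy'⟩ := add_smul_mem_of_tendsto_direction (hcl a) (hcv a) (fun i => (hx i).2) hn
    ht ⟨q, hq, rfl⟩ hr
  refine ⟨y, hy, ?_⟩
  have : y = q + r • z := by
    apply add_right_cancel (b := a)
    simp only at hy'
    rw [hy']; abel
  simp only [this]
  abel

end

/-! ### Intersecting the cylinders -/

/-- The point equals (1 - ε)(y + tv) + εk with t = εs/(1 - ε), and the bound on ε says |t| ≤ 1. -/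
theorem mem_of_smul_add_smul_mem {E : Type*} [AddCommGroup E] [Module ℝ E] {K C : Set E}
    (hK : Convex ℝ K) {v : E} (h : ∀ t ∈ Icc (-1 : ℝ) 1, ∀ x ∈ C, x + t • v ∈ K) {k y : E}
    (hk : k ∈ K) (hy : y ∈ C) {s ε : ℝ} (hε : 0 < ε) (hs : ε * (|s| + 1) ≤ 1) (hε1 : ε < 1) :
    y + ε • (k + s • v - y) ∈ K := by
  have h1 : 0 < 1 - ε := by linarith
  have ht : ε * s / (1 - ε) ∈ Icc (-1 : ℝ) 1 := by
    rw [mem_Icc, ← abs_le, abs_div, abs_mul, abs_of_pos hε, abs_of_pos h1, div_le_one h1]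
    linarith
  have := hK (h _ ht y hy) hk h1.le hε.le (by ring)
  convert this using 1
  rw [smul_add, smul_smul, mul_div_cancel₀ _ h1.ne']
  module

/-- If `K ∩ M` can be moved a little along `v` inside `K` and along `u` inside `M`, then
intersecting the cylinders generated by `K` and `M` adds no points. -/
theorem mem_inter_of_mem_cylinders {E : Type*} [AddCommGroup E] [Module ℝ E] [TopologicalSpace E]
    [IsTopologicalAddGroup E] [ContinuousSMul ℝ E] {K M : Set E} (hK : Convex ℝ K)
    (hM : Convex ℝ M) (hC : IsClosed (K ∩ M)) (hne : (K ∩ M).Nonempty) {v u : E}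
    (hv : ∀ t ∈ Icc (-1 : ℝ) 1, ∀ x ∈ K ∩ M, x + t • v ∈ K)
    (hu : ∀ t ∈ Icc (-1 : ℝ) 1, ∀ x ∈ K ∩ M, x + t • u ∈ M) {k l x : E} (hk : k ∈ K) (hl : l ∈ M)
    {s r : ℝ} (hs : x = k + s • v) (hr : x = l + r • u) : x ∈ K ∩ M := by
  obtain ⟨c, hc⟩ := hne
  let f : ℝ → E := fun q => c + q • (x - c)
  have hf : Continuous f := by fun_prop
  have hT : IsCompact (Icc (0 : ℝ) 1 ∩ f ⁻¹' (K ∩ M)) := isCompact_Icc.inter_right (hC.preimage hf)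
  -- Take the last point of K ∩ M on the segment from c to x; if it is not x, a further small step
  -- towards x stays in K ∩ M.
  obtain ⟨q, ⟨hq, hqC⟩, hmax⟩ := hT.exists_isGreatest ⟨0, by simp, by simpa [f] using hc⟩
  rcases hq.2.eq_or_lt with rfl | hlt
  · simpa [f] using hqC
  exfalso
  let ε : ℝ := 1 / (2 + |s| + |r|)
  have hden : 0 < 2 + |s| + |r| := by positivity
  have hε : 0 < ε := by positivity
  have hε1 : ε < 1 := by
    rw [div_lt_one hden]; linarith [abs_nonneg s, abs_nonneg r]
  have hεe : ε * (2 + |s| + |r|) = 1 := by simp only [ε]; field_simp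
  have h1 : ε * (|s| + 1) ≤ 1 := by nlinarith [abs_nonneg r]
  have h2 : ε * (|r| + 1) ≤ 1 := by nlinarith [abs_nonneg s]
  have e : f (q + ε * (1 - q)) = f q + ε • (x - f q) := by
    simp only [f]; module
  have hmem : f (q + ε * (1 - q)) ∈ K ∩ M := by
    rw [e]
    refine ⟨?_, ?_⟩
    · rw [hs]; exact mem_of_smul_add_smul_mem hK hv hk hqC hε h1 hε1
    · rw [hr]; exact mem_of_smul_add_smul_mem hM hu hl hqC hε h2 hε1
  have := hmax ⟨⟨by nlinarith [hq.1], by nlinarith⟩, hmem⟩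
  nlinarith

/-! ### Translating slices and conclusion -/

variable {n : ℕ}

theorem exists_inter_translateBy_eq {K M : Set (EuclideanSpace ℝ (Fin n))} (hK : Convex ℝ K)
    (hM : Convex ℝ M) (w : EuclideanSpace ℝ (Fin n))
    (hcomp : ∀ t : ℝ, IsCompact (K ∩ translateBy M (t • w)))
    (hpos : 0 < volume (K ∩ M))
    (hconst : ∀ t ∈ Icc (-1 : ℝ) 1, volume (K ∩ translateBy M (t • w)) = volume (K ∩ M)) :
    ∃ v : EuclideanSpace ℝ (Fin n), ∀ t ∈ Icc (-1 : ℝ) 1,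
      (fun x => x + t • v) '' (K ∩ M) = K ∩ translateBy M (t • w) := by
  have hMc : ∀ t : ℝ, Convex ℝ (translateBy M (t • w)) := fun t => by
    simpa [translateBy, add_comm] using hM.translate (t • w)
  have h0 : translateBy M ((0 : ℝ) • w) = M := by simp [translateBy]
  have hcomb : ∀ l k p q : ℝ, 0 ≤ l → 0 ≤ k → l + k = 1 →
      ∀ x ∈ K ∩ translateBy M (p • w), ∀ y ∈ K ∩ translateBy M (q • w),
        l • x + k • y ∈ K ∩ translateBy M ((l * p + k * q) • w) := by
    rintro l k p q hl hk hlk x ⟨hx, m, hm, rfl⟩ y ⟨hy, m', hm', rfl⟩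
    refine ⟨hK hx hy hl hk hlk, _, hM hm hm' hl hk hlk, ?_⟩
    module
  have hm1 : (-1 : ℝ) ∈ Icc (-1 : ℝ) 1 := by norm_num
  have hp1 : (1 : ℝ) ∈ Icc (-1 : ℝ) 1 := by norm_num
  obtain ⟨c, hc⟩ := exists_eq_image_add (μ := volume) (hcomp (-1)) (hcomp 1) (hcomp 0)
    (hK.inter (hMc _)) (hK.inter (hMc _))
    (fun x hx y hy => by
      have := hcomb (1 / 2) (1 / 2) (-1) 1 (by norm_num) (by norm_num) (by norm_num) x hx y hy
      norm_num at this ⊢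
      exact this)
    (by rwa [hconst _ hm1]) (by rw [hconst _ hm1, hconst _ hp1]) (by rw [hconst _ hm1, h0])
  have key : ∀ t ∈ Icc (-1 : ℝ) 1,
      (fun x => x + ((1 + t) / 2) • c) '' (K ∩ translateBy M ((-1 : ℝ) • w)) =
        K ∩ translateBy M (t • w) := by
    intro t ht
    refine eq_of_subset_of_measure_eq (μ := volume)
      ((hcomp (-1)).image (by fun_prop)).isClosed (hK.inter (hMc t)) ?_
      (hcomp t).measure_lt_top.ne (by rwa [hconst t ht]) ?_
    · rintro _ ⟨x, hx, rfl⟩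
      have hxc : x + c ∈ K ∩ translateBy M ((1 : ℝ) • w) := hc ▸ ⟨x, hx, rfl⟩
      have := hcomb ((1 - t) / 2) ((1 + t) / 2) (-1) 1 (by linarith [ht.2]) (by linarith [ht.1])
        (by ring) x hx _ hxc
      rw [show (1 - t) / 2 * -1 + (1 + t) / 2 * 1 = t by ring] at this
      convert this using 1
      module
    · rw [image_add_right, measure_preimage_add_right, hconst t ht, hconst _ hm1]
  -- The displacement c is accumulated over a parameter interval of length 2.
  refine ⟨(1 / 2 : ℝ) • c, fun t ht => ?_⟩
  have e0 := key 0 (by norm_num)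
  rw [h0] at e0
  rw [← key t ht, ← e0, image_image]
  congr 1
  ext1 x
  module

theorem theorem2 {n : ℕ} (K L : Set (EuclideanSpace ℝ (Fin n)))
    (hKclosed : IsClosed K) (hKconvex : Convex ℝ K)
    (hLclosed : IsClosed L) (hLconvex : Convex ℝ L)
    (hproper : ∃ b : EuclideanSpace ℝ (Fin n),
      0 < crossCovariogram K L b ∧ crossCovariogram K L b < ⊤)
    (a w : EuclideanSpace ℝ (Fin n)) (hw : w ≠ 0)
    (hpos : 0 < crossCovariogram K L a)
    (hconst : ∀ t : ℝ, t ∈ Set.Icc (-1 : ℝ) 1 →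
      crossCovariogram K L (a + t • w) = crossCovariogram K L a) :
    ∃ v : EuclideanSpace ℝ (Fin n), ∀ t : ℝ, t ∈ Set.Icc (-1 : ℝ) 1 →
      K ∩ translateBy L (a + t • w) =
        cylinderGen K v ∩ translateBy (cylinderGen (translateBy L a) (v - w)) (t • w) := by
  obtain ⟨b, hb0, hb1⟩ := hproper
  have hclosed : ∀ c, IsClosed (translateBy L c) := fun c =>
    (Homeomorph.addRight c).isClosed_image.2 hLclosed
  have hM : Convex ℝ (translateBy L a) := by
    simpa [translateBy, add_comm] using hLconvex.translate a
  have htr : ∀ t : ℝ, translateBy L (a + t • w) = translateBy (translateBy L a) (t • w) := by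
    intro t
    simp only [translateBy, image_image, add_assoc]
  have hcomp : ∀ c, IsCompact (K ∩ translateBy L c) :=
    isCompact_inter_image_add hKclosed hKconvex hLclosed hLconvex hb0 hb1
  obtain ⟨v, hv⟩ := exists_inter_translateBy_eq hKconvex hM w
    (fun t => htr t ▸ hcomp _) hpos (fun t ht => htr t ▸ hconst t ht)
  have hvK : ∀ t ∈ Icc (-1 : ℝ) 1, ∀ x ∈ K ∩ translateBy L a, x + t • v ∈ K := fun t ht x hx =>
    ((hv t ht).subset ⟨x, hx, rfl⟩).1
  have hvM : ∀ t ∈ Icc (-1 : ℝ) 1, ∀ x ∈ K ∩ translateBy L a,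
      x + t • (v - w) ∈ translateBy L a := by
    intro t ht x hx
    obtain ⟨m, hm, hm'⟩ := ((hv t ht).subset ⟨x, hx, rfl⟩).2
    have : x + t • (v - w) = m := by
      rw [smul_sub, ← add_sub_assoc, sub_eq_iff_eq_add]
      exact hm'.symm
    rwa [this]
  have hne : (K ∩ translateBy L a).Nonempty := nonempty_of_measure_ne_zero hpos.ne'
  refine ⟨v, fun t ht => ?_⟩
  rw [htr]
  refine Subset.antisymm ?_ ?_
  · rintro y ⟨hyK, m, hm, rfl⟩
    exact ⟨⟨_, hyK, 0, by simp⟩, m, ⟨m, hm, 0, by simp⟩, rfl⟩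
  · rintro y ⟨⟨k, hk, s, hs⟩, _, ⟨l, hl, r, rfl⟩, hr⟩
    rw [← hv t ht]
    -- Subtracting tv reduces to t = 0: it shifts s to s - t, and tw - tv = -t(v - w) shifts r to r
    -- - t.
    refine ⟨y - t • v, ?_, sub_add_cancel y (t • v)⟩
    refine mem_inter_of_mem_cylinders hKconvex hM (hKclosed.inter (hclosed a)) hne hvK hvM hk hl
      (s := s - t) (r := r - t) ?_ ?_
    · rw [hs]; module
    · rw [← hr]; module
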